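/- Let $S=k[x_1,\dots,x_s]$ be a polynomial ring in finitely many variables over a field $k$. For a finite set $G$ of monomials of $S$, an element $m\in G$ is called dominant (with respect to $G$) if there are a variable $x$ and an integer $e\ge 1$ such that $x^e\mid m$ and $x^e\nmid m'$ for all $m'\in G\setminus\{m\}$. The set $G$ is called dominant if all of its elements are dominant with respect to $G$, and semidominant if exactly one of its elements is not dominant with respect to $G$. Let $M\subseteq S$ be a monomial ideal whose minimal generating set of monomials $G=\{m_1,\dots,m_q,n\}$ is semidominant, where $n$ is the nondominant element. (i) If $M\neq S$, then the projective dimension of $S/M$ is the largest cardinality of a dominant subset of $G$ that contains $n$: $$\operatorname{pd}(S/M)=\max\{\#D : D\subseteq G,\ n\in D,\ D\text{ is a dominant set}\}.$$ (ii) For every integer $j$ let $B_j$ be the set of all $j$-element subsets of $\{m_1,\dots,m_q\}$ whose least common multiple is not divisible by $n$ (the least common multiple of the empty set is $1$, and $B_j=\varnothing$ for $j<0$). Then the total Betti numbers $\beta_i(S/M)=\dim_k\operatorname{Tor}_i^S(k,S/M)$ are given, for all $i\ge 0$, by $$\beta_i(S/M)=\#B_i+\#B_{i-1}.$$ -/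

import Mathlib

universe u v

namespace Semidominant

/-! A monomial in the variables `σ` is its exponent vector `m : σ →₀ ℕ`. Divisibility of monomials
is then the order `≤`, and the lcm of a finite set `s` of monomials is `s.sup id` (the lcm of the
empty set being the monomial `1`, that is, the vector `0`). -/

/-- The ideal of `k[σ]` generated by the monomials in `G`. -/
noncomputable def monomialIdeal {σ : Type v} (k : Type u) [Field k] (G : Finset (σ →₀ ℕ)) :
    Ideal (MvPolynomial σ k) :=
  Ideal.span ((fun m : σ →₀ ℕ => MvPolynomial.monomial m (1 : k)) '' (G : Set (σ →₀ ℕ)))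

/-- `G` is the minimal generating set of monomials of the ideal `M`: it generates `M`, and no proper
subset of it does. -/
def IsMinimalGeneratingSet {σ : Type v} {k : Type u} [Field k] (M : Ideal (MvPolynomial σ k))
    (G : Finset (σ →₀ ℕ)) : Prop :=
  monomialIdeal k G = M ∧ ∀ G' : Finset (σ →₀ ℕ), G' ⊂ G → monomialIdeal k G' ≠ M

/-- `x` is a dominant variable of `m` with respect to `G`: for some positive `e`, the power `x ^ e`
divides `m` but divides no other element of `G`. -/
def IsDominantVariable {σ : Type v} (G : Finset (σ →₀ ℕ)) (m : σ →₀ ℕ) (x : σ) : Prop :=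
  ∃ e : ℕ, 0 < e ∧ e ≤ m x ∧ ∀ m' ∈ G, m' ≠ m → ¬ e ≤ m' x

/-- `m` is a dominant monomial with respect to `G` (for `m ∈ G`). -/
def IsDominantMonomial {σ : Type v} (G : Finset (σ →₀ ℕ)) (m : σ →₀ ℕ) : Prop :=
  ∃ x : σ, IsDominantVariable G m x

/-- Every element of `G` is dominant with respect to `G`. -/
def IsDominantSet {σ : Type v} (G : Finset (σ →₀ ℕ)) : Prop :=
  ∀ m ∈ G, IsDominantMonomial G m

/-- Exactly one element of `G` is not dominant with respect to `G`. -/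
def IsSemidominantSet {σ : Type v} (G : Finset (σ →₀ ℕ)) : Prop :=
  ∃! n : σ →₀ ℕ, n ∈ G ∧ ¬ IsDominantMonomial G n

open Classical in
/-- The set `B_j` of the `j`-element subsets of `G \ {n}` whose lcm is not divisible by `n`. The
index is an integer, and `B_j` is empty for `j < 0`. -/
noncomputable def B {σ : Type v} (G : Finset (σ →₀ ℕ)) (n : σ →₀ ℕ) (j : ℤ) :
    Finset (Finset (σ →₀ ℕ)) :=
  {s ∈ (G.erase n).powerset | (s.card : ℤ) = j ∧ ¬ n ≤ s.sup id}

/-- The quotient `S / M` as an object of the category of modules over `S = k[σ]`. -/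
noncomputable abbrev quotientModule {σ : Type v} {k : Type u} [Field k]
    (M : Ideal (MvPolynomial σ k)) : ModuleCat.{max u v} (MvPolynomial σ k) :=
  ModuleCat.of (MvPolynomial σ k) (MvPolynomial σ k ⧸ M)

/-- The `i`-th total Betti number of a module `N` over `S = k[σ]`: the dimension over `k` of
`Tor_i^S(k, N)`, where `k` is the `S`-module `S / (x : x ∈ σ)`. It is a cardinal, so that no
finiteness is presupposed. -/
noncomputable def bettiNumber {σ : Type v} {k : Type u} [Field k] (i : ℕ)
    (N : ModuleCat.{max u v} (MvPolynomial σ k)) : Cardinal.{max u v} :=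
  Module.rank k
    ((ModuleCat.restrictScalars (MvPolynomial.C : k →+* MvPolynomial σ k)).obj
      (((CategoryTheory.Tor (ModuleCat.{max u v} (MvPolynomial σ k)) i).obj
        (quotientModule (MvPolynomial.idealOfVars σ k))).obj N))

end Semidominant

/-! Let K be the simplicial complex of all t ⊆ G such that n does not divide the lcm of t \ {n}
(`minimalFaces`), each face labelled by its lcm. The labelled complex K supports a minimal free
resolution of S/M. Exactness is checked one monomial at a time. For a monomial x^a in M, the faces
whose label divides x^a form a cone (`exists_apex`): with apex n if n divides x^a, and otherwise
with apex any generator dividing x^a, because then every set of generators dividing x^a is a face.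
Coning off cycles gives preimages (`exists_differential_eq`). Minimality holds because every face is
a dominant set, so deleting a vertex always changes the lcm. Hence the i-th Betti number is the
number of faces with i vertices. Those without n form B_i and those with n correspond to B_{i-1}.
The projective dimension is the largest size of a face; such a face contains n, and the faces
containing n are exactly the dominant subsets of G containing n. -/

namespace Semidominant

/-! ### Signs for simplicial boundaries. -/

section Incidence

variable {ι : Type*} [DecidableEq ι]

/-- The usual sign, (-1) to the number of vertices of `s` preceding `m` in an auxiliary well-order.
Only these two identities are used afterwards, so the order can be forgotten. -/
theorem exists_incidence (ι : Type*) [DecidableEq ι] :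
    ∃ ε : ι → Finset ι → ℤ, (∀ m s, ε m s * ε m s = 1) ∧
      ∀ s, ∀ m ∈ s, ∀ m' ∈ s, m ≠ m' →
        ε m s * ε m' (s.erase m) = -(ε m' s * ε m (s.erase m')) := by
  classical
  let _ : LinearOrder ι := linearOrderOfSTO (WellOrderingRel (α := ι))
  refine ⟨fun m s => (-1) ^ (s.filter (· < m)).card, fun m s => ?_, ?_⟩
  · rw [← mul_pow]; simp
  · have key : ∀ s : Finset ι, ∀ m ∈ s, ∀ m' ∈ s, m < m' →
        (-1 : ℤ) ^ (s.filter (· < m)).card * (-1) ^ ((s.erase m).filter (· < m')).card =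
        -((-1) ^ (s.filter (· < m')).card * (-1) ^ ((s.erase m').filter (· < m)).card) := by
      intro s m hm m' hm' h
      have h1 : (s.erase m').filter (· < m) = s.filter (· < m) := by
        ext x
        simp only [Finset.mem_filter, Finset.mem_erase]
        exact ⟨fun hx => ⟨hx.1.2, hx.2⟩, fun hx => ⟨⟨(hx.2.trans h).ne, hx.1⟩, hx.2⟩⟩
      have h2 : (s.filter (· < m')).card = ((s.erase m).filter (· < m')).card + 1 := by
        rw [Finset.filter_erase, Finset.card_erase_add_one]
        simp [hm, h]
      rw [h1, h2, pow_succ]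
      ring
    intro s m hm m' hm' hne
    rcases lt_or_gt_of_ne hne with h | h
    · exact key s m hm m' hm' h
    · have := key s m' hm' m hm h
      dsimp only
      rw [this, neg_neg]

/-- Incidence numbers `±1` of the facets of simplices with vertices in `ι`. -/
noncomputable def incidence (m : ι) (s : Finset ι) : ℤ :=
  (exists_incidence ι).choose m s

theorem incidence_mul_self (m : ι) (s : Finset ι) : incidence m s * incidence m s = 1 :=
  (exists_incidence ι).choose_spec.1 m s

theorem incidence_mul_incidence_erase {s : Finset ι} {m m' : ι} (hm : m ∈ s) (hm' : m' ∈ s)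
    (h : m ≠ m') :
    incidence m s * incidence m' (s.erase m) = -(incidence m' s * incidence m (s.erase m')) :=
  (exists_incidence ι).choose_spec.2 s m hm m' hm' h

theorem incidence_erase_mul_incidence {s : Finset ι} {m m' : ι} (hm : m ∈ s) (hm' : m' ∈ s)
    (h : m ≠ m') :
    incidence m' s * incidence m s = -(incidence m (s.erase m') * incidence m' (s.erase m)) := by
  have h1 := incidence_mul_incidence_erase hm hm' h
  have h2 := incidence_mul_self m' s
  have h3 := incidence_mul_self m' (s.erase m)
  linear_combination incidence m' s * incidence m' (s.erase m) * h1
    - incidence m' s * incidence m s * h3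
    + (-incidence m (s.erase m') * incidence m' (s.erase m)) * h2

end Incidence

/-! ### The augmented chain complex of the full simplex and its cone homotopy. -/

section Boundary

variable {ι : Type*} [DecidableEq ι] {A A' : Type*} [AddCommGroup A] [AddCommGroup A']

/-- The boundary map on families indexed by the simplices with vertices in `G`. -/
noncomputable def boundary (G : Finset ι) (f : Finset ι → A) (t : Finset ι) : A :=
  ∑ m ∈ G \ t, incidence m (insert m t) • f (insert m t)

/-- The operator joining every simplex with the vertex `m`. -/
noncomputable def join (m : ι) (f : Finset ι → A) (t : Finset ι) : A :=
  if m ∈ t then incidence m t • f (t.erase m) else 0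

theorem boundary_boundary (G : Finset ι) (f : Finset ι → A) :
    boundary G (boundary G f) = 0 := by
  ext t
  simp only [boundary, Finset.smul_sum, smul_smul, Pi.zero_apply]
  rw [Finset.sum_sigma']
  -- Adding two vertices in either order reaches the same simplex with opposite signs.
  refine Finset.sum_involution (fun p _ => ⟨p.2, p.1⟩) ?_ ?_ ?_ ?_
  · rintro ⟨m, m'⟩ h
    simp only [Finset.mem_sigma, Finset.mem_sdiff, Finset.mem_insert, not_or] at h
    dsimp only
    rw [Finset.insert_comm m' m t, ← add_smul]
    have := incidence_mul_incidence_erase (s := insert m (insert m' t)) (m := m) (m' := m')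
      (by simp) (by simp) (Ne.symm h.2.2.1)
    have e1 : (insert m (insert m' t)).erase m = insert m' t :=
      Finset.erase_insert (by simp [h.1.2, Ne.symm h.2.2.1])
    have e2 : (insert m (insert m' t)).erase m' = insert m t := by
      rw [Finset.insert_comm]
      exact Finset.erase_insert (by simp [h.2.2.2, h.2.2.1])
    rw [e1, e2] at this
    rw [mul_comm, mul_comm (incidence m' (insert m' t)), this]
    simp
  · rintro ⟨m, m'⟩ h - heq
    simp only [Finset.mem_sigma, Finset.mem_sdiff, Finset.mem_insert, not_or] at h
    simp only [Sigma.mk.injEq] at heq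
    exact h.2.2.1 heq.1
  · rintro ⟨m, m'⟩ h
    simp only [Finset.mem_sigma, Finset.mem_sdiff, Finset.mem_insert, not_or] at h ⊢
    exact ⟨⟨h.2.1, h.2.2.2⟩, h.1.1, Ne.symm h.2.2.1, h.1.2⟩
  · rintro ⟨m, m'⟩ h
    rfl

/-- Joining with a vertex contracts the full simplex. The empty simplex is included, so there is no
exceptional degree. -/
theorem boundary_join_add_join_boundary {G : Finset ι} {m : ι} (hm : m ∈ G)
    (f : Finset ι → A) : boundary G (join m f) + join m (boundary G f) = f := by
  ext t
  rw [Pi.add_apply]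
  by_cases h : m ∈ t
  · have e : G \ t.erase m = insert m (G \ t) := by
      ext x
      simp only [Finset.mem_sdiff, Finset.mem_erase, Finset.mem_insert]
      by_cases hx : x = m
      · subst hx; simp [hm]
      · simp [hx]
    rw [join, if_pos h, boundary, boundary, e, Finset.sum_insert (by simp [h]),
      Finset.insert_erase h, smul_add, smul_smul, incidence_mul_self, one_smul, Finset.smul_sum,
      add_left_comm, ← Finset.sum_add_distrib, Finset.sum_eq_zero, add_zero]
    intro x hx
    have hxt := (Finset.mem_sdiff.1 hx).2
    have hxm : x ≠ m := fun h' => hxt (h' ▸ h)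
    have e2 : insert x (t.erase m) = (insert x t).erase m :=
      (Finset.erase_insert_of_ne hxm).symm
    rw [join, if_pos (Finset.mem_insert_of_mem h), e2, smul_smul, smul_smul,
      incidence_erase_mul_incidence (s := insert x t) (m := m) (m' := x)
        (Finset.mem_insert_of_mem h) (Finset.mem_insert_self _ _) hxm.symm,
      Finset.erase_insert hxt, neg_smul, neg_add_cancel]
  · rw [show join m (boundary G f) t = 0 from if_neg h, add_zero, boundary,
      Finset.sum_eq_single_of_mem m (by simp [hm, h])]
    · rw [join, if_pos (Finset.mem_insert_self _ _), Finset.erase_insert h, smul_smul,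
        incidence_mul_self, one_smul]
    · intro x _ hx
      rw [join, if_neg (by simp [h, Ne.symm hx]), smul_zero]

theorem boundary_map (G : Finset ι) (φ : A →+ A') (f : Finset ι → A) :
    boundary G (fun t => φ (f t)) = fun t => φ (boundary G f t) := by
  ext t
  simp [boundary]

theorem boundary_sum (G : Finset ι) {κ : Type*} (s : Finset κ) (f : κ → Finset ι → A) :
    boundary G (∑ j ∈ s, f j) = ∑ j ∈ s, boundary G (f j) := by
  ext t
  simp only [boundary, Finset.sum_apply, Finset.smul_sum]
  rw [Finset.sum_comm]

/-- The boundary map as a linear map. -/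
noncomputable def boundaryHom (R : Type*) [CommRing R] (G : Finset ι) :
    (Finset ι → R) →ₗ[R] (Finset ι → R) where
  toFun := boundary G
  map_add' f g := by
    ext t
    simp [boundary, Finset.sum_add_distrib]
  map_smul' c f := by
    ext t
    simp [boundary, Finset.mul_sum, mul_left_comm]

end Boundary

open MvPolynomial

section Preliminaries

variable {σ : Type v} {k : Type u} [Field k] {ι : Type*}

/-- The faces of `K` with `i` vertices. -/
def faces (K : Finset (Finset ι)) (i : ℕ) : Finset (Finset ι) := K.filter (·.card = i)

theorem mem_faces {K : Finset (Finset ι)} {i : ℕ} {t : Finset ι} :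
    t ∈ faces K i ↔ t ∈ K ∧ t.card = i := Finset.mem_filter

theorem mem_span_monomials {G : Finset ι} {ℓ : ι → σ →₀ ℕ} {f : MvPolynomial σ k} :
    f ∈ Ideal.span ((fun m => monomial (ℓ m) (1 : k)) '' (G : Set ι)) ↔
      ∀ a ∈ f.support, ∃ m ∈ G, ℓ m ≤ a := by
  have := mem_ideal_span_monomial_image (R := k) (x := f) (s := ℓ '' (G : Set ι))
  rw [Set.image_image] at this
  simpa using this

end Preliminaries

/-! ### The cellular complex of a labelled simplicial complex. -/

section Cellular

variable {σ : Type v} (k : Type u) [Field k] {ι : Type*} [DecidableEq ι]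
  (K : Finset (Finset ι)) (ℓ : ι → σ →₀ ℕ) (G : Finset ι)

/-- The `i`-th free module of the cellular complex of `K`. -/
abbrev Chains (i : ℕ) := faces K i → MvPolynomial σ k

open Classical in
/-- The embedding of the cellular complex of the labelled simplicial complex `K` into families of
polynomials, multiplying the coefficient of a face by its label. -/
noncomputable def homogenize (i : ℕ) :
    Chains (σ := σ) k K i →ₗ[MvPolynomial σ k] (Finset ι → MvPolynomial σ k) where
  toFun c t := if h : t ∈ faces K i then monomial (t.sup ℓ) 1 * c ⟨t, h⟩ else 0
  map_add' c c' := by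
    ext1 t
    simp only [Pi.add_apply]
    split_ifs <;> simp [mul_add]
  map_smul' a c := by
    ext1 t
    simp only [Pi.smul_apply, smul_eq_mul, RingHom.id_apply]
    split_ifs <;> simp [mul_left_comm]

variable {k K ℓ G}

theorem homogenize_of_mem {i : ℕ} (c : Chains k K i) {t : Finset ι} (h : t ∈ faces K i) :
    homogenize k K ℓ i c t = monomial (t.sup ℓ) 1 * c ⟨t, h⟩ := dif_pos h

theorem homogenize_of_notMem {i : ℕ} (c : Chains k K i) {t : Finset ι} (h : t ∉ faces K i) :
    homogenize k K ℓ i c t = 0 := dif_neg h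

theorem homogenize_injective (i : ℕ) : Function.Injective (homogenize k K ℓ i) := by
  intro c c' h
  ext1 ⟨t, ht⟩
  have := congrFun h t
  rw [homogenize_of_mem c ht, homogenize_of_mem c' ht] at this
  exact mul_left_cancel₀ (by simp) this

/-- Inside families of polynomials, chains are cut out by a condition on supports alone, and the
differential is the plain signed boundary without monomial coefficients. Lifting to a chain becomes
a divisibility check. -/
theorem mem_range_homogenize {i : ℕ} {f : Finset ι → MvPolynomial σ k} :
    f ∈ LinearMap.range (homogenize k K ℓ i) ↔
      ∀ t, ∀ a ∈ (f t).support, t ∈ faces K i ∧ t.sup ℓ ≤ a := by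
  constructor
  · rintro ⟨c, rfl⟩ t a ha
    by_cases h : t ∈ faces K i
    · rw [homogenize_of_mem c h, mem_support_iff, coeff_monomial_mul'] at ha
      exact ⟨h, by_contra fun h' => ha (if_neg h')⟩
    · simp [homogenize_of_notMem c h] at ha
  · intro H
    have hd : ∀ t : Finset ι, ∃ p, f t = monomial (t.sup ℓ) 1 * p := by
      intro t
      have : f t ∈ Ideal.span ((fun s : σ →₀ ℕ => monomial s (1 : k)) '' {t.sup ℓ}) :=
        mem_ideal_span_monomial_image.2 fun a ha => ⟨_, rfl, (H t a ha).2⟩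
      rw [Set.image_singleton, Ideal.mem_span_singleton] at this
      exact this
    choose p hp using hd
    refine ⟨fun t => p t, ?_⟩
    ext1 t
    by_cases h : t ∈ faces K i
    · rw [homogenize_of_mem _ h, hp]
    · rw [homogenize_of_notMem _ h]
      refine (support_eq_empty.1 (Finset.eq_empty_of_forall_notMem fun a ha => ?_)).symm
      exact h (H t a ha).1

theorem exists_mem_support_of_mem_support_boundary {f : Finset ι → MvPolynomial σ k}
    {t : Finset ι} {a : σ →₀ ℕ} (ha : a ∈ (boundary G f t).support) :
    ∃ m ∈ G, m ∉ t ∧ a ∈ (f (insert m t)).support := by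
  by_contra! H
  rw [mem_support_iff, boundary, coeff_sum] at ha
  refine ha (Finset.sum_eq_zero fun m hm => ?_)
  rw [Finset.mem_sdiff] at hm
  have := H m hm.1 hm.2
  rw [notMem_support_iff] at this
  rw [← coeffAddMonoidHom_apply, map_zsmul, coeffAddMonoidHom_apply, this, smul_zero]

variable (k ℓ G) in
theorem boundary_homogenize_mem (hK : IsLowerSet (K : Set (Finset ι))) (i : ℕ)
    (c : Chains (σ := σ) k K (i + 1)) :
    boundaryHom (MvPolynomial σ k) G (homogenize k K ℓ (i + 1) c) ∈
      LinearMap.range (homogenize k K ℓ i) := by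
  rw [mem_range_homogenize]
  intro t a ha
  obtain ⟨m, -, hmt, hm⟩ := exists_mem_support_of_mem_support_boundary ha
  obtain ⟨h1, h2⟩ := mem_range_homogenize.1 (LinearMap.mem_range_self _ c) _ _ hm
  rw [mem_faces, Finset.card_insert_of_notMem hmt] at h1
  exact ⟨mem_faces.2 ⟨hK (Finset.subset_insert m t) h1.1, Nat.succ.inj h1.2⟩,
    (Finset.sup_mono (Finset.subset_insert m t)).trans h2⟩

variable (k ℓ G) in
/-- The differential of the cellular complex of `K`. -/
noncomputable def differential (hK : IsLowerSet (K : Set (Finset ι))) (i : ℕ) :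
    Chains (σ := σ) k K (i + 1) →ₗ[MvPolynomial σ k] Chains (σ := σ) k K i :=
  (LinearEquiv.ofInjective _ (homogenize_injective (ℓ := ℓ) i)).symm.toLinearMap ∘ₗ
    LinearMap.codRestrict _ (boundaryHom _ G ∘ₗ homogenize k K ℓ (i + 1))
      (boundary_homogenize_mem k ℓ G hK i)

variable (hK : IsLowerSet (K : Set (Finset ι)))

theorem homogenize_differential (i : ℕ) (c : Chains k K (i + 1)) :
    homogenize k K ℓ i (differential k ℓ G hK i c) =
      boundary G (homogenize k K ℓ (i + 1) c) := by
  have := LinearEquiv.apply_symm_apply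
    (LinearEquiv.ofInjective _ (homogenize_injective (k := k) (K := K) (ℓ := ℓ) i))
    (LinearMap.codRestrict _ (boundaryHom _ G ∘ₗ homogenize k K ℓ (i + 1))
      (boundary_homogenize_mem k ℓ G hK i) c)
  exact congrArg Subtype.val this

theorem differential_comp_differential (i : ℕ) :
    differential k ℓ G hK i ∘ₗ differential k ℓ G hK (i + 1) = 0 := by
  refine LinearMap.ext fun c => homogenize_injective (ℓ := ℓ) i ?_
  rw [LinearMap.comp_apply, homogenize_differential, homogenize_differential, boundary_boundary,
    LinearMap.zero_apply, map_zero]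

/-- The cellular complex is minimal when removing a vertex from a face changes its label. -/
theorem constantCoeff_differential
    (hmin : ∀ t ∈ K, ∀ m ∈ t, ¬ t.sup ℓ ≤ (t.erase m).sup ℓ) (i : ℕ)
    (c : Chains k K (i + 1)) (t : faces K i) :
    constantCoeff (differential k ℓ G hK i c t) = 0 := by
  have h := congrFun (homogenize_differential (ℓ := ℓ) (G := G) hK i c) t
  rw [homogenize_of_mem _ t.2] at h
  -- The constant term sought is the coefficient of the label of `t` in the homogenized boundary.
  -- Were it nonzero, the label of some larger face `insert m t` would divide that of `t`.
  have h' := congrArg (coeff ((t : Finset ι).sup ℓ)) h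
  rw [coeff_monomial_mul', if_pos le_rfl, tsub_self, one_mul] at h'
  rw [constantCoeff_eq, h', ← notMem_support_iff]
  intro ha
  obtain ⟨m, -, hmt, hm⟩ := exists_mem_support_of_mem_support_boundary ha
  obtain ⟨h1, h2⟩ := mem_range_homogenize.1 (LinearMap.mem_range_self _ c) _ _ hm
  have := hmin _ (mem_faces.1 h1).1 m (Finset.mem_insert_self _ _)
  rw [Finset.erase_insert hmt] at this
  exact this h2

variable (k) in
/-- The projection of a polynomial onto the span of the monomials satisfying `p`. -/
noncomputable def restrictMonomials (p : (σ →₀ ℕ) → Prop) [DecidablePred p] :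
    MvPolynomial σ k →ₗ[k] MvPolynomial σ k :=
  (basisMonomials σ k).constr k fun a => if p a then monomial a 1 else 0

theorem coeff_restrictMonomials (p : (σ →₀ ℕ) → Prop) [DecidablePred p] (f : MvPolynomial σ k)
    (a : σ →₀ ℕ) : coeff a (restrictMonomials k p f) = if p a then coeff a f else 0 := by
  classical
  have : lcoeff k a ∘ₗ restrictMonomials k p = if p a then lcoeff k a else 0 := by
    refine (basisMonomials σ k).ext fun b => ?_
    rw [LinearMap.comp_apply, restrictMonomials, Module.Basis.constr_basis]
    by_cases hab : b = a
    · subst hab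
      split_ifs <;> simp
    · split_ifs <;> simp [coeff_monomial, hab]
  have h := LinearMap.congr_fun this f
  rw [LinearMap.comp_apply, lcoeff_apply] at h
  rw [h]
  split_ifs <;> simp

theorem support_restrictMonomials {p : (σ →₀ ℕ) → Prop} [DecidablePred p] {f : MvPolynomial σ k}
    {a : σ →₀ ℕ} (ha : a ∈ (restrictMonomials k p f).support) : p a ∧ a ∈ f.support := by
  rw [mem_support_iff, coeff_restrictMonomials] at ha
  rw [mem_support_iff]
  by_cases h : p a
  · exact ⟨h, by rwa [if_pos h] at ha⟩
  · exact absurd (if_neg h) ha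

/-- If in every multidegree the subcomplex of `K` is a cone, then every cycle whose monomials lie in
the monomial ideal is a boundary. -/
theorem exists_differential_eq (apex : (σ →₀ ℕ) → ι)
    (hapex : ∀ a, (∃ m ∈ G, ℓ m ≤ a) → apex a ∈ G ∧ ℓ (apex a) ≤ a ∧
      ∀ t ∈ K, t.sup ℓ ≤ a → insert (apex a) t ∈ K)
    (i : ℕ) (c : Chains k K i) (hc : boundary G (homogenize k K ℓ i c) = 0)
    (hdiv : ∀ t, ∀ a ∈ (homogenize k K ℓ i c t).support, ∃ m ∈ G, ℓ m ≤ a) :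
    ∃ c', differential k ℓ G hK i c' = c := by
  classical
  set f := homogenize k K ℓ i c with hf
  -- The cycle is split according to the apex assigned to each monomial. The boundary preserves
  -- monomials, so each piece is again a cycle and is the boundary of its join with its own apex.
  let π (m : ι) : MvPolynomial σ k →ₗ[k] MvPolynomial σ k := restrictMonomials k (apex · = m)
  let g : Finset ι → MvPolynomial σ k := ∑ m ∈ G, join m fun t => π m (f t)
  have hg : boundary G g = f := by
    have hterm : ∀ m ∈ G, boundary G (join m fun t => π m (f t)) = fun t => π m (f t) := by
      intro m hm
      have h := boundary_join_add_join_boundary hm fun t => π m (f t)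
      have h0 : boundary G (fun t => π m (f t)) = 0 := by
        have := boundary_map G (π m).toAddMonoidHom f
        rw [hc] at this
        refine this.trans ?_
        ext1 t
        simp
      have h1 : join m (0 : Finset ι → MvPolynomial σ k) = 0 := by
        ext1 t
        simp [join]
      rwa [h0, h1, add_zero] at h
    rw [boundary_sum, Finset.sum_congr rfl hterm]
    ext t a
    rw [Finset.sum_apply, coeff_sum]
    simp only [π, coeff_restrictMonomials, Finset.sum_ite_eq]
    split_ifs with h
    · rfl
    · refine (notMem_support_iff.1 fun ha => h ?_).symm
      exact (hapex a (hdiv t a ha)).1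
  have hmem : g ∈ LinearMap.range (homogenize k K ℓ (i + 1)) := by
    refine Submodule.sum_mem _ fun m hm => mem_range_homogenize.2 fun t a ha => ?_
    by_cases hmt : m ∈ t
    · have ha' : a ∈ (π m (f (t.erase m))).support := by
        rw [join, if_pos hmt] at ha
        rw [mem_support_iff] at ha ⊢
        contrapose! ha
        rw [← coeffAddMonoidHom_apply, map_zsmul, coeffAddMonoidHom_apply, ha, smul_zero]
      obtain ⟨rfl, ha''⟩ := support_restrictMonomials ha'
      obtain ⟨-, h2, h3⟩ := hapex a (hdiv _ a ha'')
      obtain ⟨h4, h5⟩ := mem_range_homogenize.1 (LinearMap.mem_range_self _ c) _ _ ha''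
      have h6 := h3 _ (mem_faces.1 h4).1 h5
      rw [Finset.insert_erase hmt] at h6
      refine ⟨mem_faces.2 ⟨h6, ?_⟩, ?_⟩
      · rw [← (mem_faces.1 h4).2, Finset.card_erase_add_one hmt]
      · rw [← Finset.insert_erase hmt, Finset.sup_insert]
        exact sup_le h2 h5
    · simp [join, hmt] at ha
  obtain ⟨c', hc'⟩ := hmem
  refine ⟨c', homogenize_injective (ℓ := ℓ) i ?_⟩
  rw [homogenize_differential, hc', hg]

theorem exists_differential_eq_of_differential_eq_zero (apex : (σ →₀ ℕ) → ι)
    (hapex : ∀ a, (∃ m ∈ G, ℓ m ≤ a) → apex a ∈ G ∧ ℓ (apex a) ≤ a ∧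
      ∀ t ∈ K, t.sup ℓ ≤ a → insert (apex a) t ∈ K) (hKG : ∀ t ∈ K, t ⊆ G)
    (i : ℕ) (c : Chains k K (i + 1)) (hc : differential k ℓ G hK i c = 0) :
    ∃ c', differential k ℓ G hK (i + 1) c' = c := by
  refine exists_differential_eq hK apex hapex (i + 1) c ?_ fun t a ha => ?_
  · rw [← homogenize_differential hK, hc, map_zero]
  · obtain ⟨h1, h2⟩ := mem_range_homogenize.1 (LinearMap.mem_range_self _ c) _ _ ha
    rw [mem_faces] at h1
    obtain ⟨m, hm⟩ := Finset.card_pos.1 (by rw [h1.2]; exact Nat.succ_pos i)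
    exact ⟨m, hKG t h1.1 hm, (Finset.le_sup hm).trans h2⟩

variable (k K ℓ) in
/-- The augmentation of the cellular complex. -/
noncomputable def augmentation (M : Ideal (MvPolynomial σ k)) :
    Chains (σ := σ) k K 0 →ₗ[MvPolynomial σ k] MvPolynomial σ k ⧸ M :=
  M.mkQ ∘ₗ LinearMap.proj (R := MvPolynomial σ k) (φ := fun _ : Finset ι => MvPolynomial σ k) ∅ ∘ₗ
    homogenize k K ℓ 0

theorem augmentation_comp_differential {M : Ideal (MvPolynomial σ k)}
    (hM : M = Ideal.span ((fun m => monomial (ℓ m) (1 : k)) '' (G : Set ι))) :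
    augmentation k K ℓ M ∘ₗ differential k ℓ G hK 0 = 0 := by
  refine LinearMap.ext fun c => ?_
  rw [LinearMap.zero_apply, LinearMap.comp_apply, augmentation, LinearMap.comp_apply,
    LinearMap.comp_apply, homogenize_differential, Submodule.mkQ_apply,
    Submodule.Quotient.mk_eq_zero, hM, mem_span_monomials]
  intro a ha
  obtain ⟨m, hmG, -, hm⟩ := exists_mem_support_of_mem_support_boundary ha
  obtain ⟨h1, h2⟩ := mem_range_homogenize.1 (LinearMap.mem_range_self _ c) _ _ hm
  exact ⟨m, hmG, (Finset.le_sup (Finset.mem_insert_self _ _)).trans h2⟩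

theorem exists_differential_eq_of_augmentation_eq_zero {M : Ideal (MvPolynomial σ k)}
    (hM : M = Ideal.span ((fun m => monomial (ℓ m) (1 : k)) '' (G : Set ι)))
    (apex : (σ →₀ ℕ) → ι)
    (hapex : ∀ a, (∃ m ∈ G, ℓ m ≤ a) → apex a ∈ G ∧ ℓ (apex a) ≤ a ∧
      ∀ t ∈ K, t.sup ℓ ≤ a → insert (apex a) t ∈ K)
    (c : Chains k K 0) (hc : augmentation k K ℓ M c = 0) :
    ∃ c', differential k ℓ G hK 0 c' = c := by
  refine exists_differential_eq hK apex hapex 0 c ?_ fun t a ha => ?_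
  · ext1 t
    refine support_eq_empty.1 (Finset.eq_empty_of_forall_notMem fun a ha => ?_)
    obtain ⟨m, -, -, hm⟩ := exists_mem_support_of_mem_support_boundary ha
    have h1 := (mem_range_homogenize.1 (LinearMap.mem_range_self _ c) _ _ hm).1
    simpa using (mem_faces.1 h1).2
  · have h1 := (mem_range_homogenize.1 (LinearMap.mem_range_self _ c) _ _ ha).1
    obtain rfl := Finset.card_eq_zero.1 (mem_faces.1 h1).2
    rw [augmentation, LinearMap.comp_apply, LinearMap.comp_apply, Submodule.mkQ_apply,
      Submodule.Quotient.mk_eq_zero, hM, mem_span_monomials] at hc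
    exact hc a ha

/-- For M = S the target is zero, so K may even lack the empty face. -/
theorem augmentation_surjective {M : Ideal (MvPolynomial σ k)} (h : M ≠ ⊤ → ∅ ∈ K) :
    Function.Surjective (augmentation k K ℓ M) := by
  by_cases hM : M = ⊤
  · subst hM
    exact fun x => ⟨0, Subsingleton.elim _ _⟩
  · intro x
    obtain ⟨p, rfl⟩ := Submodule.Quotient.mk_surjective _ x
    refine ⟨fun _ => p, ?_⟩
    rw [augmentation, LinearMap.comp_apply, LinearMap.comp_apply, LinearMap.proj_apply,
      homogenize_of_mem _ (mem_faces.2 ⟨h hM, Finset.card_empty⟩)]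
    rw [Finset.sup_empty, bot_eq_zero]
    simp

end Cellular

open CategoryTheory MvPolynomial

/-! ### Projective resolutions from exact sequences. -/

section OfExact

variable {R : Type u} [CommRing R] {X : ℕ → ModuleCat.{w} R} (d : ∀ i, X (i + 1) ⟶ X i)
  (hd : ∀ i, Function.Exact (d (i + 1)) (d i)) {Z : ModuleCat.{w} R} (ε : X 0 ⟶ Z)
  (hdε : Function.Exact (d 0) ε) (hε : Function.Surjective ε)

/-- The chain complex of an exact sequence of modules. -/
noncomputable def complexOfExact : ChainComplex (ModuleCat.{w} R) ℕ :=
  ChainComplex.of X d fun i => by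
    ext x
    exact (hd i).apply_apply_eq_zero x

theorem complexOfExact_d (i : ℕ) : (complexOfExact d hd).d (i + 1) i = d i :=
  ChainComplex.of_d X d i

include hdε in
theorem complexOfExact_d_comp : (complexOfExact d hd).d 1 0 ≫ ε = 0 := by
  refine (congrArg (· ≫ ε) (complexOfExact_d d hd 0)).trans ?_
  ext x
  exact hdε.apply_apply_eq_zero x

variable [∀ i, Projective (X i)]

/-- The projective resolution given by an exact sequence of modules. -/
noncomputable def resolutionOfExact : ProjectiveResolution Z where
  complex := complexOfExact d hd
  projective n := inferInstanceAs (Projective (X n))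
  π := (ChainComplex.toSingle₀Equiv _ _).symm ⟨ε, complexOfExact_d_comp d hd ε hdε⟩
  quasiIso := ⟨fun n => by
    cases n with
    | zero =>
      rw [ChainComplex.quasiIsoAt₀_iff, ShortComplex.quasiIso_iff_of_zeros']
      · have h0 := ChainComplex.toSingle₀Equiv_symm_apply_f_zero (C := complexOfExact d hd) ε
          (complexOfExact_d_comp d hd ε hdε)
        refine (ShortComplex.exact_and_epi_g_iff_of_iso
          (S₂ := ShortComplex.mk (d 0) ε (by ext x; exact hdε.apply_apply_eq_zero x)) ?_).2 ⟨?_, ?_⟩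
        · refine ShortComplex.isoMk (Iso.refl _) (Iso.refl _) (Iso.refl _) ?_ ?_
          · exact (Category.id_comp (d 0)).trans
              ((complexOfExact_d d hd 0).symm.trans (Category.comp_id _).symm)
          · exact (Category.id_comp ε).trans (h0.symm.trans (Category.comp_id _).symm)
        · rwa [ShortComplex.ShortExact.moduleCat_exact_iff_function_exact]
        · exact (ModuleCat.epi_iff_surjective _).2 hε
      all_goals rfl
    | succ n =>
      rw [quasiIsoAt_iff_exactAt']
      · rw [HomologicalComplex.exactAt_iff' _ (n + 1 + 1) (n + 1) n (by simp) (by simp),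
          ShortComplex.ShortExact.moduleCat_exact_iff_function_exact]
        simp only [HomologicalComplex.sc', HomologicalComplex.shortComplexFunctor',
          complexOfExact_d]
        exact hd n
      · apply ChainComplex.exactAt_succ_single_obj⟩

end OfExact

section Homology

variable {C : Type*} [Category* C] [Abelian C]

/-- The homology of a complex with zero differentials. -/
noncomputable def homologyIsoOfZeros (L : ChainComplex C ℕ) (h : ∀ i j, L.d i j = 0) (i : ℕ) :
    L.homology i ≅ L.X i :=
  (ShortComplex.HomologyData.ofZeros (L.sc i) (h _ _) (h _ _)).left.homologyIso

end Homology

/-! ### Bounds on projective dimension read off a resolution. -/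

section ProjectiveDimension

variable {C : Type*} [Category* C] [Abelian C] {Z : C} (P : ProjectiveResolution Z)

theorem hasProjectiveDimensionLT_of_isZero {r : ℕ}
    (h : ∀ i, r ≤ i → Limits.IsZero (P.complex.X i)) : HasProjectiveDimensionLT Z r := by
  let _ := HasExt.standard C
  rw [hasProjectiveDimensionLT_iff]
  intro i hi Y e
  obtain ⟨f, hf, rfl⟩ := P.extMk_surjective e (i + 1) rfl
  obtain rfl := (h i hi).eq_of_src f 0
  simp

/-- By `hY` all coboundaries vanish in degree r + 1, so the nonzero cocycle `f` represents a nonzero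
class in Ext. -/
theorem not_hasProjectiveDimensionLT {r : ℕ} {Y : C} (f : P.complex.X (r + 1) ⟶ Y) (hf0 : f ≠ 0)
    (hf : P.complex.d (r + 2) (r + 1) ≫ f = 0)
    (hY : ∀ g : P.complex.X r ⟶ Y, P.complex.d (r + 1) r ≫ g = 0) :
    ¬ HasProjectiveDimensionLT Z (r + 1) := by
  let _ := HasExt.standard C
  intro h
  have := Abelian.Ext.eq_zero_of_hasProjectiveDimensionLT
    (P.extMk f (r + 2) rfl hf) (r + 1) le_rfl
  rw [P.extMk_eq_zero_iff _ _ _ _ r rfl] at this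
  obtain ⟨g, rfl⟩ := this
  exact hf0 (hY g)

end ProjectiveDimension

/-! ### The residue field k = S/(x : x ∈ σ). -/

section Residue

variable (σ : Type v) (k : Type u) [Field k]

theorem mem_idealOfVars_iff (p : MvPolynomial σ k) :
    p ∈ idealOfVars σ k ↔ constantCoeff p = 0 := by
  rw [← pow_one (idealOfVars σ k), mem_pow_idealOfVars_iff', constantCoeff_eq]
  simp [Finsupp.degree_eq_zero_iff]

theorem exists_equiv_residue (κ : Type v) [Fintype κ] :
    Nonempty (((ModuleCat.restrictScalars (C : k →+* MvPolynomial σ k)).obj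
      (ModuleCat.of _ (κ → MvPolynomial σ k ⧸ idealOfVars σ k))) ≃ₗ[k] (κ → k)) := by
  let φ : MvPolynomial σ k ⧸ idealOfVars σ k →+* k :=
    Ideal.Quotient.lift _ constantCoeff fun p hp => (mem_idealOfVars_iff σ k p).1 hp
  have hφ : Function.Bijective φ := by
    constructor
    · refine RingHom.lift_injective_of_ker_le_ideal _ _ fun p hp => ?_
      exact (mem_idealOfVars_iff σ k p).2 hp
    · intro a
      exact ⟨Ideal.Quotient.mk _ (C a), by simp [φ]⟩
  let ψ : ((ModuleCat.restrictScalars (C : k →+* MvPolynomial σ k)).obj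
      (ModuleCat.of _ (κ → MvPolynomial σ k ⧸ idealOfVars σ k))) →ₗ[k] (κ → k) :=
    { toFun := fun f t => φ ((f : κ → MvPolynomial σ k ⧸ idealOfVars σ k) t)
      map_add' := fun f g => by
        ext t
        exact map_add φ _ _
      map_smul' := fun a f => by
        ext t
        have : φ (Ideal.Quotient.mk _ (C a) *
            (f : κ → MvPolynomial σ k ⧸ idealOfVars σ k) t) = a * φ (f t) := by
          rw [map_mul]
          simp [φ]
        exact this }
  refine ⟨LinearEquiv.ofBijective ψ ⟨?_, ?_⟩⟩
  · intro f g h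
    exact funext fun t => hφ.1 (congrFun h t)
  · intro f
    exact ⟨fun t => (hφ.2 (f t)).choose, funext fun t => (hφ.2 (f t)).choose_spec⟩

variable {σ k} in
theorem tmul_eq_zero {κ : Type*} [Fintype κ] (c : κ → MvPolynomial σ k)
    (hc : ∀ t, constantCoeff (c t) = 0) (x : MvPolynomial σ k ⧸ idealOfVars σ k) :
    TensorProduct.tmul (MvPolynomial σ k) x c = 0 := by
  classical
  refine (LinearEquiv.map_eq_zero_iff (TensorProduct.piScalarRight (MvPolynomial σ k)
    (MvPolynomial σ k) (MvPolynomial σ k ⧸ idealOfVars σ k) κ)).1 ?_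
  rw [TensorProduct.piScalarRight_apply, TensorProduct.piScalarRightHom_tmul]
  ext1 t
  obtain ⟨p, rfl⟩ := Ideal.Quotient.mk_surjective x
  have : Ideal.Quotient.mk (idealOfVars σ k) (c t * p) = 0 := by
    rw [Ideal.Quotient.eq_zero_iff_mem, mem_idealOfVars_iff, map_mul, hc, zero_mul]
  exact this

end Residue

/-! ### Betti numbers and projective dimension from a minimal free resolution. -/

section Minimal

variable {σ : Type v} {k : Type u} [Field k] {Z : ModuleCat.{max u v} (MvPolynomial σ k)}
  {κ : ℕ → Type v} [∀ i, Fintype (κ i)]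
  (d : ∀ i, (κ (i + 1) → MvPolynomial σ k) →ₗ[MvPolynomial σ k] (κ i → MvPolynomial σ k))
  (ε : (κ 0 → MvPolynomial σ k) →ₗ[MvPolynomial σ k] Z)
  (hd : ∀ i, Function.Exact (d (i + 1)) (d i)) (hdε : Function.Exact (d 0) ε)
  (hε : Function.Surjective ε)

/-- The projective resolution given by an exact sequence of finite free modules. -/
noncomputable def freeResolution : ProjectiveResolution Z :=
  haveI (i : ℕ) : Projective (ModuleCat.of (MvPolynomial σ k) (κ i → MvPolynomial σ k)) :=
    (IsProjective.iff_projective _).1 inferInstance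
  resolutionOfExact (X := fun i => ModuleCat.of (MvPolynomial σ k) (κ i → MvPolynomial σ k))
    (fun i => ModuleCat.ofHom (d i)) hd (ModuleCat.ofHom ε) hdε hε

theorem freeResolution_d (i : ℕ) :
    (freeResolution d ε hd hdε hε).complex.d (i + 1) i = ModuleCat.ofHom (d i) :=
  complexOfExact_d (X := fun i => ModuleCat.of (MvPolynomial σ k) (κ i → MvPolynomial σ k))
    (fun i => ModuleCat.ofHom (d i)) hd i

variable (hmin : ∀ i c t, constantCoeff (d i c t) = 0)

include hmin hd hdε hε in
theorem bettiNumber_of_minimal (i : ℕ) : bettiNumber i Z = Fintype.card (κ i) := by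
  classical
  let P := freeResolution d ε hd hdε hε
  let F := (MonoidalCategory.tensoringLeft (ModuleCat.{max u v} (MvPolynomial σ k))).obj
    (quotientModule (idealOfVars σ k))
  -- Minimality makes every differential vanish after tensoring with k, so Tor is the tensored term
  -- itself.
  have hz : ∀ i, F.map (P.complex.d (i + 1) i) = 0 := by
    intro i
    rw [freeResolution_d]
    apply ModuleCat.hom_ext
    refine TensorProduct.ext' fun x c => ?_
    exact tmul_eq_zero (d i c) (hmin i c) x
  have hz' : ∀ i j, ((F.mapHomologicalComplex (ComplexShape.down ℕ)).obj P.complex).d i j = 0 := by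
    intro i j
    by_cases hij : (ComplexShape.down ℕ).Rel i j
    · obtain rfl : j + 1 = i := hij
      exact hz j
    · exact HomologicalComplex.shape _ _ _ hij
  let e₁ : ((Tor (ModuleCat.{max u v} (MvPolynomial σ k)) i).obj
      (quotientModule (idealOfVars σ k))).obj Z ≅ F.obj (P.complex.X i) :=
    P.isoLeftDerivedObj F i ≪≫ homologyIsoOfZeros _ hz' i
  let e₂ : F.obj (P.complex.X i) ≅
      ModuleCat.of (MvPolynomial σ k) (κ i → MvPolynomial σ k ⧸ idealOfVars σ k) :=
    (TensorProduct.piScalarRight (MvPolynomial σ k) (MvPolynomial σ k)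
      (MvPolynomial σ k ⧸ idealOfVars σ k) (κ i)).toModuleIso
  let e₃ := ((ModuleCat.restrictScalars (C : k →+* MvPolynomial σ k)).mapIso
    (e₁ ≪≫ e₂)).toLinearEquiv
  obtain ⟨e₄⟩ := exists_equiv_residue σ k (κ i)
  have h := (e₃.trans e₄).lift_rank_eq
  rw [rank_fun'] at h
  rw [bettiNumber]
  simpa using h

-- The upper bound is the length of the resolution. For the lower bound, a coordinate projection
-- followed by S → k is a nonzero cocycle, and minimality kills all coboundaries with values in k.
include hmin hd hdε hε in
theorem projectiveDimension_of_minimal (r : ℕ) (hr : Nonempty (κ (r + 1)))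
    (hr' : ∀ i, r + 1 < i → IsEmpty (κ i)) :
    projectiveDimension Z = ((r + 1 : ℕ) : WithBot ℕ∞) := by
  classical
  let P := freeResolution d ε hd hdε hε
  have hle : HasProjectiveDimensionLT Z (r + 2) := by
    refine hasProjectiveDimensionLT_of_isZero P fun i hi => ?_
    have := hr' i hi
    have : Subsingleton (ModuleCat.of (MvPolynomial σ k) (κ i → MvPolynomial σ k)) :=
      inferInstanceAs (Subsingleton (κ i → MvPolynomial σ k))
    exact ModuleCat.isZero_of_subsingleton
      (ModuleCat.of (MvPolynomial σ k) (κ i → MvPolynomial σ k))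
  have hzero : ∀ i (g : ModuleCat.of (MvPolynomial σ k) (κ i → MvPolynomial σ k) ⟶
      quotientModule (idealOfVars σ k)), ModuleCat.ofHom (d i) ≫ g = 0 := by
    intro i g
    ext1
    refine LinearMap.ext fun c => ?_
    have h := LinearMap.pi_apply_eq_sum_univ g.hom (d i c)
    refine h.trans (Finset.sum_eq_zero fun t _ => ?_)
    generalize g.hom _ = x
    obtain ⟨p, rfl⟩ := Ideal.Quotient.mk_surjective x
    have : Ideal.Quotient.mk (idealOfVars σ k) (d i c t * p) = 0 := by
      rw [Ideal.Quotient.eq_zero_iff_mem, mem_idealOfVars_iff, map_mul, hmin, zero_mul]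
    exact this
  have hge : ¬ HasProjectiveDimensionLT Z (r + 1) := by
    let t := hr.some
    let f : ModuleCat.of (MvPolynomial σ k) (κ (r + 1) → MvPolynomial σ k) ⟶
        quotientModule (idealOfVars σ k) :=
      ModuleCat.ofHom ((idealOfVars σ k).mkQ ∘ₗ LinearMap.proj t)
    refine not_hasProjectiveDimensionLT P (Y := quotientModule (idealOfVars σ k)) f ?_ ?_ ?_
    · intro hf
      have := LinearMap.congr_fun (congrArg ModuleCat.Hom.hom hf) (fun _ => 1)
      have h1 : Ideal.Quotient.mk (idealOfVars σ k) 1 = 0 := this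
      rw [Ideal.Quotient.eq_zero_iff_mem, mem_idealOfVars_iff, map_one] at h1
      exact one_ne_zero h1
    · exact (congrArg (· ≫ f) (freeResolution_d d ε hd hdε hε (r + 1))).trans (hzero _ f)
    · intro g
      exact (congrArg (· ≫ g) (freeResolution_d d ε hd hdε hε r)).trans (hzero _ g)
  refine le_antisymm ?_ ?_
  · exact (projectiveDimension_le_iff _ _).2 hle
  · rw [projectiveDimension_ge_iff]
    exact hge

end Minimal

/-! ### The simplicial complex attached to a semidominant set. -/

section MinimalFaces

variable {σ : Type v} {G : Finset (σ →₀ ℕ)} {n : σ →₀ ℕ}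

open Classical in
/-- The simplicial complex of all sets of monomials in `G` such that `n` does not divide the lcm of
the elements different from `n`. -/
noncomputable def minimalFaces (G : Finset (σ →₀ ℕ)) (n : σ →₀ ℕ) :
    Finset (Finset (σ →₀ ℕ)) :=
  {t ∈ G.powerset | ¬ n ≤ (t.erase n).sup id}

theorem mem_minimalFaces [DecidableEq (σ →₀ ℕ)] {t : Finset (σ →₀ ℕ)} :
    t ∈ minimalFaces G n ↔ t ⊆ G ∧ ¬ n ≤ (t.erase n).sup id := by
  rw [minimalFaces, Finset.mem_filter, Finset.mem_powerset]
  convert Iff.rfl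

theorem isLowerSet_minimalFaces :
    IsLowerSet (minimalFaces G n : Set (Finset (σ →₀ ℕ))) := by
  classical
  intro t s hst ht
  rw [Finset.mem_coe, mem_minimalFaces] at ht ⊢
  exact ⟨hst.trans ht.1, fun h => ht.2 (h.trans (Finset.sup_mono (Finset.erase_subset_erase n hst)))⟩

theorem le_sup_apply {t : Finset (σ →₀ ℕ)} {x : σ} {e : ℕ} (he : 0 < e) (h : e ≤ t.sup id x) :
    ∃ m ∈ t, e ≤ m x := by
  classical
  have h' : e ≤ t.sup fun m => m x := by
    refine h.trans_eq ?_
    exact Finset.apply_sup_eq_sup_comp (fun m : σ →₀ ℕ => m x) (fun _ _ => rfl) rfl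
  exact (Finset.le_sup_iff he).1 h'

/-- If `m` fails to divide the lcm of the others, it does so at some variable `x`, and the exponent
`m x` witnesses dominance. This links dominance to the face condition. -/
theorem isDominantMonomial_iff {t : Finset (σ →₀ ℕ)} [DecidableEq (σ →₀ ℕ)] {m : σ →₀ ℕ} :
    IsDominantMonomial t m ↔ ¬ m ≤ (t.erase m).sup id := by
  constructor
  · rintro ⟨x, e, he, hem, h⟩ hle
    obtain ⟨m', hm', h'⟩ := le_sup_apply he (hem.trans (hle x))
    exact h m' (Finset.mem_of_mem_erase hm') (Finset.ne_of_mem_erase hm') h'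
  · intro h
    rw [Finsupp.le_def] at h
    push Not at h
    obtain ⟨x, hx⟩ := h
    refine ⟨x, m x, (Nat.zero_le _).trans_lt hx, le_rfl, fun m' hm' hne hle => ?_⟩
    have : m' ≤ (t.erase m).sup id := Finset.le_sup (f := id) (Finset.mem_erase.2 ⟨hne, hm'⟩)
    exact absurd (hle.trans (this x)) hx.not_ge

theorem IsDominantMonomial.mono {s t : Finset (σ →₀ ℕ)} (hst : s ⊆ t) {m : σ →₀ ℕ}
    (h : IsDominantMonomial t m) : IsDominantMonomial s m := by
  obtain ⟨x, e, he, hem, h⟩ := h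
  exact ⟨x, e, he, hem, fun m' hm' => h m' (hst hm')⟩

variable (hdom : ∀ m ∈ G, m ≠ n → IsDominantMonomial G m)

-- Vertices other than `n` are already dominant in G, and dominance passes to subsets. For `n`
-- itself, dominance in the face is the condition defining the complex.
include hdom in
theorem isDominantSet_of_mem_minimalFaces {t : Finset (σ →₀ ℕ)} (ht : t ∈ minimalFaces G n) :
    IsDominantSet t := by
  classical
  obtain ⟨h1, h2⟩ := mem_minimalFaces.1 ht
  intro m hm
  by_cases hmn : m = n
  · subst hmn
    rw [isDominantMonomial_iff]
    exact h2
  · exact (hdom m (h1 hm) hmn).mono h1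

include hdom in
theorem mem_minimalFaces_iff_isDominantSet {t : Finset (σ →₀ ℕ)} (hnt : n ∈ t) :
    t ∈ minimalFaces G n ↔ t ⊆ G ∧ IsDominantSet t := by
  classical
  refine ⟨fun h => ⟨(mem_minimalFaces.1 h).1, isDominantSet_of_mem_minimalFaces hdom h⟩,
    fun h => mem_minimalFaces.2 ⟨h.1, ?_⟩⟩
  exact isDominantMonomial_iff.1 (h.2 n hnt)

theorem insert_mem_minimalFaces [DecidableEq (σ →₀ ℕ)] (hn : n ∈ G) {t : Finset (σ →₀ ℕ)}
    (ht : t ∈ minimalFaces G n) : insert n t ∈ minimalFaces G n := by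
  rw [mem_minimalFaces] at ht ⊢
  refine ⟨Finset.insert_subset hn ht.1, ?_⟩
  have : (insert n t).erase n = t.erase n := by
    ext x
    simp only [Finset.mem_erase, Finset.mem_insert]
    tauto
  rw [this]
  exact ht.2

theorem exists_apex [DecidableEq (σ →₀ ℕ)] (hn : n ∈ G) :
    ∃ apex : (σ →₀ ℕ) → σ →₀ ℕ, ∀ a, (∃ m ∈ G, id m ≤ a) → apex a ∈ G ∧ id (apex a) ≤ a ∧
      ∀ t ∈ minimalFaces G n, t.sup id ≤ a → insert (apex a) t ∈ minimalFaces G n := by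
  have : ∀ a : σ →₀ ℕ, ∃ b, (∃ m ∈ G, id m ≤ a) → b ∈ G ∧ id b ≤ a ∧
      ∀ t ∈ minimalFaces G n, t.sup id ≤ a → insert b t ∈ minimalFaces G n := by
    intro a
    by_cases hna : n ≤ a
    · exact ⟨n, fun _ => ⟨hn, hna, fun t ht _ => insert_mem_minimalFaces hn ht⟩⟩
    · by_cases hG : ∃ m ∈ G, id m ≤ a
      · obtain ⟨m, hm, hma⟩ := hG
        refine ⟨m, fun _ => ⟨hm, hma, fun t ht hta => ?_⟩⟩
        rw [mem_minimalFaces] at ht ⊢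
        -- Everything in `insert m t` divides `a` while `n` does not, so the face condition is
        -- automatic.
        refine ⟨Finset.insert_subset hm ht.1, fun h => hna (h.trans ?_)⟩
        refine (Finset.sup_mono (Finset.erase_subset _ _)).trans ?_
        rw [Finset.sup_insert]
        exact sup_le hma hta
      · exact ⟨a, fun h => absurd h hG⟩
  choose apex h using this
  exact ⟨apex, h⟩

include hdom in
theorem not_sup_le_of_mem_minimalFaces [DecidableEq (σ →₀ ℕ)] :
    ∀ t ∈ minimalFaces G n, ∀ m ∈ t, ¬ t.sup id ≤ (t.erase m).sup id := by
  intro t ht m hm h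
  have := isDominantSet_of_mem_minimalFaces hdom ht m hm
  rw [isDominantMonomial_iff] at this
  exact this ((Finset.le_sup (f := id) hm).trans h)

theorem empty_mem_minimalFaces (hn : n ≠ 0) : ∅ ∈ minimalFaces G n := by
  classical
  rw [mem_minimalFaces]
  refine ⟨Finset.empty_subset _, fun h => hn ?_⟩
  rw [Finset.erase_empty, Finset.sup_empty] at h
  exact le_bot_iff.1 h

theorem card_faces_minimalFaces (hn : n ∈ G) (i : ℕ) :
    (faces (minimalFaces G n) i).card = (B G n i).card + (B G n ((i : ℤ) - 1)).card := by
  classical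
  rw [← Finset.card_filter_add_card_filter_not (s := faces (minimalFaces G n) i) (n ∉ ·)]
  congr 1
  · congr 1
    ext t
    simp only [B, Finset.mem_filter, mem_faces, mem_minimalFaces, Finset.mem_powerset,
      Finset.subset_erase, Nat.cast_inj]
    constructor
    · rintro ⟨⟨⟨h1, h2⟩, h3⟩, h4⟩
      rw [Finset.erase_eq_of_notMem h4] at h2
      exact ⟨⟨h1, h4⟩, h3, h2⟩
    · rintro ⟨⟨h1, h4⟩, h3, h2⟩
      refine ⟨⟨⟨h1, ?_⟩, h3⟩, h4⟩
      rwa [Finset.erase_eq_of_notMem h4]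
  -- The face condition ignores `n`, so removing it loses only one vertex. For i = 0 both sides are
  -- empty, which is why the index is an integer.
  · refine Finset.card_bij' (fun t _ => t.erase n) (fun t _ => insert n t) ?_ ?_ ?_ ?_
    · intro t ht
      simp only [B, Finset.mem_filter, mem_faces, mem_minimalFaces, Finset.mem_powerset,
        not_not] at ht ⊢
      obtain ⟨⟨⟨h1, h2⟩, h3⟩, h4⟩ := ht
      refine ⟨Finset.erase_subset_erase n h1, ?_, h2⟩
      have := Finset.card_erase_add_one h4
      omega
    · intro t ht
      simp only [B, Finset.mem_filter, mem_faces, mem_minimalFaces, Finset.mem_powerset,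
        Finset.subset_erase, not_not] at ht ⊢
      obtain ⟨⟨h1, h4⟩, h3, h2⟩ := ht
      refine ⟨⟨⟨Finset.insert_subset hn h1, ?_⟩, ?_⟩, Finset.mem_insert_self _ _⟩
      · rwa [Finset.erase_insert h4]
      · rw [Finset.card_insert_of_notMem h4]
        omega
    · intro t ht
      simp only [Finset.mem_filter, not_not] at ht
      exact Finset.insert_erase ht.2
    · intro t ht
      simp only [B, Finset.mem_filter, Finset.mem_powerset, Finset.subset_erase] at ht
      exact Finset.erase_insert ht.1.2

variable {k : Type u} [Field k]

include hdom in
theorem exists_minimal_resolution (hn : n ∈ G) {M : Ideal (MvPolynomial σ k)}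
    (hM : monomialIdeal k G = M) (hn0 : M ≠ ⊤ → n ≠ 0) :
    ∃ (d : ∀ i, Chains (σ := σ) k (minimalFaces G n) (i + 1) →ₗ[MvPolynomial σ k]
        Chains (σ := σ) k (minimalFaces G n) i)
      (ε : Chains (σ := σ) k (minimalFaces G n) 0 →ₗ[MvPolynomial σ k] quotientModule M),
      (∀ i, Function.Exact (d (i + 1)) (d i)) ∧ Function.Exact (d 0) ε ∧
        Function.Surjective ε ∧ ∀ i c t, constantCoeff (d i c t) = 0 := by
  classical
  obtain ⟨apex, hapex⟩ := exists_apex hn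
  have hK := isLowerSet_minimalFaces (G := G) (n := n)
  refine ⟨differential k id G hK, augmentation k _ id M, fun i c => ⟨?_, ?_⟩,
    fun c => ⟨?_, ?_⟩, ?_, ?_⟩
  · exact exists_differential_eq_of_differential_eq_zero hK apex hapex
      (fun t ht => (mem_minimalFaces.1 ht).1) i c
  · rintro ⟨c', rfl⟩
    exact LinearMap.congr_fun (differential_comp_differential hK i) c'
  · exact exists_differential_eq_of_augmentation_eq_zero hK hM.symm apex hapex c
  · rintro ⟨c', rfl⟩
    exact LinearMap.congr_fun (augmentation_comp_differential hK hM.symm) c'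
  · exact augmentation_surjective fun h => empty_mem_minimalFaces (hn0 h)
  · exact constantCoeff_differential hK (not_sup_le_of_mem_minimalFaces hdom)

theorem ne_zero_of_monomialIdeal_ne_top (hn : n ∈ G) {M : Ideal (MvPolynomial σ k)}
    (hM : monomialIdeal k G = M) (h : M ≠ ⊤) : n ≠ 0 := by
  rintro rfl
  refine h ((Ideal.eq_top_iff_one _).2 ?_)
  rw [← hM]
  exact Ideal.subset_span ⟨0, hn, rfl⟩

end MinimalFaces

end Semidominant

theorem corollary5p11 {σ : Type v} [Finite σ] {k : Type u} [Field k]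
    (M : Ideal (MvPolynomial σ k)) (G : Finset (σ →₀ ℕ))
    (hG : Semidominant.IsMinimalGeneratingSet M G)
    (hsemi : Semidominant.IsSemidominantSet G)
    (n : σ →₀ ℕ) (hn : n ∈ G) (hnd : ¬ Semidominant.IsDominantMonomial G n) :
    (M ≠ ⊤ →
      ∃ r : ℕ,
        IsGreatest
          {c : ℕ | ∃ D : Finset (σ →₀ ℕ),
            D ⊆ G ∧ n ∈ D ∧ Semidominant.IsDominantSet D ∧ D.card = c} r ∧
        CategoryTheory.projectiveDimension (Semidominant.quotientModule M) = (r : WithBot ℕ∞)) ∧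
    ∀ i : ℕ,
      Semidominant.bettiNumber i (Semidominant.quotientModule M) =
        (((Semidominant.B G n (i : ℤ)).card + (Semidominant.B G n ((i : ℤ) - 1)).card : ℕ) :
          Cardinal.{max u v}) := by
  classical
  open Semidominant in
  have hdom : ∀ m ∈ G, m ≠ n → IsDominantMonomial G m := fun m hm hmn =>
    by_contra fun h => hmn (hsemi.unique ⟨hm, h⟩ ⟨hn, hnd⟩)
  have hn0 := ne_zero_of_monomialIdeal_ne_top hn hG.1
  obtain ⟨d, ε, hd, hdε, hε, hmin⟩ := exists_minimal_resolution hdom hn hG.1 hn0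
  refine ⟨fun hM => ?_, fun i => ?_⟩
  · have hne : (minimalFaces G n).Nonempty := ⟨_, empty_mem_minimalFaces (hn0 hM)⟩
    obtain ⟨D, hD, hmax⟩ := Finset.exists_max_image (minimalFaces G n) Finset.card hne
    -- The complex is a cone over `n`, so a face of maximal size contains it. In particular its size
    -- is positive, as the form r + 1 below requires.
    have hnD : n ∈ D := by
      by_contra h
      have := hmax _ (insert_mem_minimalFaces hn hD)
      rw [Finset.card_insert_of_notMem h] at this
      omega
    obtain ⟨r, hr⟩ : ∃ r, D.card = r + 1 :=
      Nat.exists_eq_add_one.2 (Finset.card_pos.2 ⟨n, hnD⟩)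
    refine ⟨r + 1, ⟨⟨D, ?_⟩, ?_⟩, ?_⟩
    · obtain ⟨h1, h2⟩ := (mem_minimalFaces_iff_isDominantSet hdom hnD).1 hD
      exact ⟨h1, hnD, h2, hr⟩
    · rintro c ⟨D', h1, h2, h3, rfl⟩
      rw [← hr]
      exact hmax D' ((mem_minimalFaces_iff_isDominantSet hdom h2).2 ⟨h1, h3⟩)
    · refine projectiveDimension_of_minimal (κ := fun i => faces (minimalFaces G n) i) d ε hd hdε hε hmin r
        ⟨⟨D, mem_faces.2 ⟨hD, hr⟩⟩⟩ fun i hi => ⟨fun t => ?_⟩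
      obtain ⟨h1, h2⟩ := mem_faces.1 t.2
      have := hmax _ h1
      omega
  · rw [bettiNumber_of_minimal (κ := fun i => faces (minimalFaces G n) i) d ε hd hdε hε hmin i, Fintype.card_coe,
      card_faces_minimalFaces hn]
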